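/- Let $X$ be a real Hilbert space and let $f,g\colon X\to\left]-\infty,+\infty\right]$ be proper and lower semicontinuous. An abstract subdifferential $\hat\partial$ assigns to each proper lower semicontinuous $h\colon X\to\left]-\infty,+\infty\right]$ and each $x\in X$ a set $\hat\partial h(x)\subseteq X$ such that: (i) $\hat\partial h=\partial h$ (the convex subdifferential) if $h$ is convex; (ii) $\hat\partial h(x)=\{\nabla h(x)\}$ for all $x$ if $h$ is real-valued and continuously differentiable; (iii) $0\in\hat\partial h(x)$ if $h$ attains a local minimum at $x\in\operatorname{dom}h$; (iv) $\hat\partial\bigl(h+\tfrac{\beta}{2}\|\cdot-x\|^2\bigr)(z)=\hat\partial h(z)+\beta(z-x)$ for all $\beta\in\mathbb R$ and $x,z\in X$. (The Clarke--Rockafellar, Mordukhovich and Fréchet subdifferentials are examples.) For $\lambda\ge 0$, $h$ is $\lambda$-hypoconvex if $h((1-\tau)x+\tau y)\le(1-\tau)h(x)+\tau h(y)+\tfrac{\lambda}{2}\tau(1-\tau)\|x-y\|^2$ for all $x,y\in X$, $\tau\in\left]0,1\right[$; $h$ is $\lambda$-strongly convex if $h((1-\tau)x+\tau y)+\tfrac{\lambda}{2}\tau(1-\tau)\|x-y\|^2\le(1-\tau)h(x)+\tau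 h(y)$ for all such $x,y,\tau$. For $\gamma>0$ put $\operatorname{prox}_{\gamma h}(x)=\operatorname{argmin}_{y\in X}\bigl(h(y)+\tfrac{1}{2\gamma}\|x-y\|^2\bigr)$. A map $T\colon X\to X$ is $\alpha$-averaged if $\alpha\in\left]0,1\right[$ and $T=(1-\alpha)\mathrm{Id}+\alpha N$ for some nonexpansive $N\colon X\to X$. **Theorem.** Let $\hat\partial$ be an abstract subdifferential, let $\mu>\omega\ge0$ and let $0<\gamma<\frac{\mu-\omega}{2\mu\omega}$ (the upper bound being $+\infty$ if $\omega=0$). Suppose that either $f$ is $\mu$-strongly convex and $g$ is $\omega$-hypoconvex, or $f$ is $\omega$-hypoconvex and $g$ is $\mu$-strongly convex, and that $0\in\hat\partial f(z)+\hat\partial g(z)$ for some $z\in X$. Then $\operatorname{prox}_{\gamma f}$ and $\operatorname{prox}_{\gamma g}$ are single-valued and defined on all of $X$. Set $$T=\tfrac12\bigl(\mathrm{Id}+(2\operatorname{prox}_{\gamma g}-\mathrm{Id})(2\operatorname{prox}_{\gamma f}-\mathrm{Id})\bigr),\qquad \alpha=\frac{\mu-\omega}{2(\mu-\omega-\gamma\mu\omega)}.$$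 Then $\alpha\in\left]0,1\right[$ and $T$ is $\alpha$-averaged. Moreover, for every $x_0\in X$ there exists $\overline x\in\operatorname{Fix}T$ such that $T^nx_0\rightharpoonup\overline x$ weakly, $\operatorname{argmin}(f+g)=\{\operatorname{prox}_{\gamma f}\overline x\}$, and $\operatorname{prox}_{\gamma f}T^nx_0\to\operatorname{prox}_{\gamma f}\overline x$ in norm. -/

import Mathlib

open Set Filter Topology
open scoped Pointwise

section DouglasRachford

variable {X : Type*} [NormedAddCommGroup X] [InnerProductSpace ℝ X]

/-- A function `f : X → ]-∞, +∞]` (modelled with values in `EReal`) which is not identically `+∞`. -/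
def ProperFun (f : X → EReal) : Prop :=
  (∀ x, f x ≠ ⊥) ∧ ∃ x, f x ≠ ⊤

/-- Convexity of an extended-valued function. -/
def EConvex (f : X → EReal) : Prop :=
  ∀ x y : X, ∀ τ : ℝ, 0 < τ → τ < 1 →
    f ((1 - τ) • x + τ • y) ≤ ((1 - τ : ℝ) : EReal) * f x + (τ : EReal) * f y

/-- `μ`-strong convexity of an extended-valued function. -/
def EStronglyConvex (μ : ℝ) (f : X → EReal) : Prop :=
  ∀ x y : X, ∀ τ : ℝ, 0 < τ → τ < 1 →
    f ((1 - τ) • x + τ • y) + ((μ / 2 * (τ * (1 - τ)) * ‖x - y‖ ^ 2 : ℝ) : EReal)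
      ≤ ((1 - τ : ℝ) : EReal) * f x + (τ : EReal) * f y

/-- `ω`-hypoconvexity of an extended-valued function; `0`-hypoconvexity is convexity. -/
def EHypoconvex (ω : ℝ) (f : X → EReal) : Prop :=
  ∀ x y : X, ∀ τ : ℝ, 0 < τ → τ < 1 →
    f ((1 - τ) • x + τ • y) ≤ ((1 - τ : ℝ) : EReal) * f x + (τ : EReal) * f y
      + ((ω / 2 * (τ * (1 - τ)) * ‖x - y‖ ^ 2 : ℝ) : EReal)

/-- The subdifferential of convex analysis. For proper `f` it is empty outside `dom f`. -/
def convexSubdifferential (f : X → EReal) (x : X) : Set X :=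
  {u | ∀ y : X, f x + ((inner ℝ u (y - x) : ℝ) : EReal) ≤ f y}

/-- `S` is an abstract subdifferential: to a function `f` and a point `x` it associates a
subset `S f x` of `X`, in such a way that, on the proper lower semicontinuous functions,
it agrees with the convex subdifferential for convex functions and with the gradient for
continuously differentiable functions, contains `0` at local minimizers, and obeys the
sum rule with the quadratic functions `β ‖· - x‖² / 2`. -/
structure IsAbstractSubdifferential [CompleteSpace X] (S : (X → EReal) → X → Set X) : Prop where
  eq_convex : ∀ f : X → EReal, ProperFun f → LowerSemicontinuous f → EConvex f →
    ∀ x, S f x = convexSubdifferential f x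
  eq_gradient : ∀ φ : X → ℝ, ContDiff ℝ 1 φ →
    ∀ x, S (fun y => (φ y : EReal)) x = {gradient φ x}
  zero_mem : ∀ f : X → EReal, ProperFun f → LowerSemicontinuous f →
    ∀ x, f x ≠ ⊤ → IsLocalMin f x → (0 : X) ∈ S f x
  add_quadratic : ∀ f : X → EReal, ProperFun f → LowerSemicontinuous f →
    ∀ (β : ℝ) (x z : X),
      S (fun y => f y + ((β * (‖y - x‖ ^ 2 / 2) : ℝ) : EReal)) z = S f z + {β • (z - x)}

/-- The set of global minimizers of an extended-valued function. -/
def argminSet (h : X → EReal) : Set X :=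
  {x | ∀ y, h x ≤ h y}

/-- The set of minimizers of `y ↦ f y + ‖x - y‖² / (2γ)`. -/
def proxSet (γ : ℝ) (f : X → EReal) (x : X) : Set X :=
  argminSet fun y => f y + ((1 / (2 * γ) * ‖x - y‖ ^ 2 : ℝ) : EReal)

/-- The proximal mapping `prox_{γ f}`: the point of `proxSet γ f x` when that set is a singleton
(an arbitrary choice otherwise). -/
noncomputable def prox (γ : ℝ) (f : X → EReal) (x : X) : X :=
  Classical.epsilon fun y => y ∈ proxSet γ f x

/-- `T = ½ (Id + (2 prox_{γ g} - Id) ∘ (2 prox_{γ f} - Id))`. -/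
noncomputable def drMap (γ : ℝ) (f g : X → EReal) (x : X) : X :=
  (1 / 2 : ℝ) • (x + ((2 : ℝ) • prox γ g ((2 : ℝ) • prox γ f x - x)
    - ((2 : ℝ) • prox γ f x - x)))

/-- `T` is `α`-averaged: `α ∈ ]0, 1[` and `T = (1 - α) Id + α N` with `N` nonexpansive. -/
def IsAveraged (α : ℝ) (T : X → X) : Prop :=
  α ∈ Ioo (0 : ℝ) 1 ∧ ∃ N : X → X, LipschitzWith 1 N ∧ ∀ x, T x = (1 - α) • x + α • N x

end DouglasRachford

/-! ### Convexity relative to a quadratic -/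

section RelativeConvexity

variable {X : Type*} [NormedAddCommGroup X] [InnerProductSpace ℝ X]

/-! Strong convexity and hypoconvexity are one notion with a signed modulus. If `f` has modulus `a`
and `g` modulus `b`, both cases of the theorem give `a + b = μ - ω > 0` and `a * b = -(μ * ω)`, and
nothing else distinguishes them.

The bound on `γ` makes the prox objectives strongly convex, so proximal points exist, are unique,
and satisfy resolvent inclusions with global subgradient inequalities (`RelSubgradient`). These give
monotonicity with moduli `a` and `b`. For increments `p`, `q` of the two resolvents, the identity
`(a + b)(a‖p‖² + b‖q‖²) = ab‖p - q‖² + ‖ap + bq‖²` yields `norm_sq_douglasRachford_le`. Its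
coefficient of `‖p - q‖²` is `κ = 1 + 2γab/(a + b) = (1 - α)/α`, which is averagedness; the bound on
`γ` says exactly that `κ > 0`.

The abstract subdifferential serves only to turn the zero of the sum into a fixed point. Weak
convergence then follows from Opial's lemma and demiclosedness. The leftover term `‖ap + bq‖²` gives
norm convergence: along the iteration `ap + bq → 0` and `p - q → 0`, and `a + b ≠ 0` forces `p → 0`.
-/

/-- Convexity relative to `a / 2 * ‖·‖ ^ 2`, for `a` of either sign: strong convexity for `0 < a`,
hypoconvexity for `a ≤ 0`. Only points of the domain are tested. -/
def RelConvex (a : ℝ) (f : X → EReal) : Prop :=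
  ∀ x y : X, ∀ τ : ℝ, 0 < τ → τ < 1 → ∀ r s : ℝ, f x = r → f y = s →
    f ((1 - τ) • x + τ • y) ≤
      (((1 - τ) * r + τ * s - a / 2 * (τ * (1 - τ)) * ‖x - y‖ ^ 2 : ℝ) : EReal)

/-- `u` is a subgradient of `f` at `p` with quadratic modulus `a`. -/
def RelSubgradient (a : ℝ) (f : X → EReal) (p u : X) : Prop :=
  ∃ r : ℝ, f p = r ∧
    ∀ y, ((r + inner ℝ u (y - p) + a / 2 * ‖y - p‖ ^ 2 : ℝ) : EReal) ≤ f y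

theorem EReal.exists_eq_coe_of_ne {x : EReal} (hb : x ≠ ⊥) (ht : x ≠ ⊤) : ∃ r : ℝ, x = r :=
  ⟨x.toReal, (EReal.coe_toReal ht hb).symm⟩

theorem EStronglyConvex.relConvex {a : ℝ} {f : X → EReal} (h : EStronglyConvex a f) :
    RelConvex a f := by
  intro x y τ h0 h1 r s hr hs
  have := h x y τ h0 h1
  rw [hr, hs] at this
  rw [EReal.coe_sub]
  refine EReal.le_sub_iff_add_le (Or.inl (EReal.coe_ne_bot _)) (Or.inl (EReal.coe_ne_top _)) |>.2 ?_
  exact_mod_cast this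

theorem EHypoconvex.relConvex {a : ℝ} {f : X → EReal} (h : EHypoconvex a f) :
    RelConvex (-a) f := by
  intro x y τ h0 h1 r s hr hs
  have := h x y τ h0 h1
  rw [hr, hs] at this
  refine this.trans (le_of_eq ?_)
  norm_cast
  ring

theorem norm_sq_convexCombination_sub (x y c : X) (τ : ℝ) :
    ‖(1 - τ) • x + τ • y - c‖ ^ 2 =
      (1 - τ) * ‖x - c‖ ^ 2 + τ * ‖y - c‖ ^ 2 - τ * (1 - τ) * ‖x - y‖ ^ 2 := by
  have h1 : (1 - τ) • x + τ • y - c = (1 - τ) • (x - c) + τ • (y - c) := by module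
  have h2 : ‖x - y‖ ^ 2 = ‖x - c‖ ^ 2 - 2 * inner ℝ (x - c) (y - c) + ‖y - c‖ ^ 2 := by
    rw [← norm_sub_sq_real, sub_sub_sub_cancel_right]
  rw [h1, h2, norm_add_sq_real, norm_smul, norm_smul, inner_smul_left,
    inner_smul_right, mul_pow, mul_pow]
  simp only [Real.norm_eq_abs, sq_abs, conj_trivial]
  ring

theorem RelConvex.add_quadratic {a : ℝ} {f : X → EReal} (h : RelConvex a f)
    (hf : ∀ x, f x ≠ ⊥) (β : ℝ) (c : X) :
    RelConvex (a + β) fun y => f y + ((β * (‖y - c‖ ^ 2 / 2) : ℝ) : EReal) := by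
  intro x y τ h0 h1 r s hr hs
  have key : ∀ z (t : ℝ), f z + ((β * (‖z - c‖ ^ 2 / 2) : ℝ) : EReal) = t →
      f z = ((t - β * (‖z - c‖ ^ 2 / 2) : ℝ) : EReal) := by
    intro z t hz
    have ht : f z ≠ ⊤ := by
      intro ht
      rw [ht, EReal.top_add_coe] at hz
      exact EReal.top_ne_coe _ hz
    obtain ⟨v, hv⟩ := EReal.exists_eq_coe_of_ne (hf z) ht
    rw [hv] at hz ⊢
    norm_cast at hz ⊢
    linarith
  have := add_le_add_left (h x y τ h0 h1 _ _ (key x r hr) (key y s hs))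
    ((β * (‖(1 - τ) • x + τ • y - c‖ ^ 2 / 2) : ℝ) : EReal)
  refine this.trans (le_of_eq ?_)
  rw [norm_sq_convexCombination_sub]
  norm_cast
  ring

theorem RelConvex.eConvex {f : X → EReal} (h : RelConvex 0 f) (hf : ∀ x, f x ≠ ⊥) :
    EConvex f := by
  intro x y τ h0 h1
  have hb : ∀ (t : ℝ) z, 0 < t → (t : EReal) * f z ≠ ⊥ := by
    intro t z ht
    induction hz : f z with
    | bot => exact absurd hz (hf z)
    | coe r => exact_mod_cast EReal.coe_ne_bot (t * r)
    | top => simp [EReal.coe_mul_top_of_pos ht]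
  by_cases hx : f x = ⊤
  · rw [hx, EReal.coe_mul_top_of_pos (by linarith), EReal.top_add_of_ne_bot (hb _ _ h0)]
    exact le_top
  by_cases hy : f y = ⊤
  · rw [hy, EReal.coe_mul_top_of_pos h0, EReal.add_top_of_ne_bot (hb _ _ (by linarith))]
    exact le_top
  obtain ⟨r, hr⟩ := EReal.exists_eq_coe_of_ne (hf x) hx
  obtain ⟨s, hs⟩ := EReal.exists_eq_coe_of_ne (hf y) hy
  have := h x y τ h0 h1 r s hr hs
  rw [hr, hs]
  refine this.trans (le_of_eq ?_)
  norm_cast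
  ring

omit [InnerProductSpace ℝ X] in
theorem LowerSemicontinuous.add_coe_of_continuous {f : X → EReal} (hf : LowerSemicontinuous f)
    {q : X → ℝ} (hq : Continuous q) : LowerSemicontinuous fun y => f y + (q y : EReal) :=
  hf.add' (continuous_coe_real_ereal.comp hq).lowerSemicontinuous fun _ =>
    EReal.continuousAt_add (Or.inr (EReal.coe_ne_bot _)) (Or.inr (EReal.coe_ne_top _))

omit [NormedAddCommGroup X] [InnerProductSpace ℝ X] in
theorem ProperFun.add_coe {f : X → EReal} (hf : ProperFun f) (q : X → ℝ) :
    ProperFun fun y => f y + (q y : EReal) := by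
  obtain ⟨h, x, hx⟩ := hf
  obtain ⟨r, hr⟩ := EReal.exists_eq_coe_of_ne (h x) hx
  refine ⟨fun y => ?_, x, ?_⟩
  · simp [EReal.add_eq_bot_iff, h y]
  · simp only [hr]
    exact_mod_cast EReal.coe_ne_top (r + q x)

/-! ### Minimizers for positive modulus -/

/-- Lower semicontinuity bounds `h` below near a domain point `x`. A farther `y` is compared with
the point of the segment from `x` to `y` at distance `δ` from `x`; the quadratic gain then outweighs
the linear loss. -/
theorem RelConvex.exists_lower_bound {c : ℝ} (hc : 0 < c) {h : X → EReal} (hp : ProperFun h)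
    (hl : LowerSemicontinuous h) (hh : RelConvex c h) :
    ∃ M : ℝ, ∀ y, (M : EReal) ≤ h y := by
  obtain ⟨hb, x, hx⟩ := hp
  obtain ⟨r, hr⟩ := EReal.exists_eq_coe_of_ne (hb x) hx
  have h1 : ((r - 1 : ℝ) : EReal) < h x := by rw [hr]; exact_mod_cast sub_one_lt r
  obtain ⟨ε, hε, hball⟩ := Metric.eventually_nhds_iff.1 (hl x _ h1)
  set δ := ε / 2 with hδ
  have hδ0 : 0 < δ := by positivity
  -- With `K = 1 / δ + c / 2 * δ`, the subtracted `K ^ 2 / (2 * c)` is the maximum over `d` of `K *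
  -- d - c / 2 * d ^ 2`.
  refine ⟨r - 1 - (1 / δ + c / 2 * δ) ^ 2 / (2 * c), fun y => ?_⟩
  by_cases hy : h y = ⊤
  · rw [hy]; exact le_top
  obtain ⟨s, hs⟩ := EReal.exists_eq_coe_of_ne (hb y) hy
  rw [hs]
  norm_cast
  set d := ‖x - y‖ with hd
  have hnn : 0 ≤ (1 / δ + c / 2 * δ) ^ 2 / (2 * c) := by positivity
  rcases le_or_gt d δ with hdδ | hdδ
  · have : ((r - 1 : ℝ) : EReal) < h y := hball (by rw [dist_comm, dist_eq_norm]; linarith)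
    rw [hs] at this
    have : r - 1 < s := by exact_mod_cast this
    linarith
  · have hd0 : 0 < d := hδ0.trans hdδ
    have hτ0 : 0 < δ / d := by positivity
    have hτ1 : δ / d < 1 := (div_lt_one hd0).2 hdδ
    have h2 := hh x y (δ / d) hτ0 hτ1 r s hr hs
    have h3 : ((r - 1 : ℝ) : EReal) < h ((1 - δ / d) • x + (δ / d) • y) := by
      apply hball
      rw [dist_eq_norm]
      have : (1 - δ / d) • x + (δ / d) • y - x = (δ / d) • (y - x) := by module
      rw [this, norm_smul, norm_sub_rev, Real.norm_of_nonneg hτ0.le, ← hd,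
        div_mul_cancel₀ _ hd0.ne']
      linarith
    have h4 := h3.trans_le h2
    have h4 : r - 1 < (1 - δ / d) * r + δ / d * s - c / 2 * (δ / d * (1 - δ / d)) * d ^ 2 := by
      exact_mod_cast h4
    have h5 : (r - s) * δ + c / 2 * δ * (d - δ) * d < d := by
      have e : (1 - δ / d) * r + δ / d * s - c / 2 * (δ / d * (1 - δ / d)) * d ^ 2
          = r - ((r - s) * δ + c / 2 * δ * (d - δ) * d) / d := by
        field_simp
        ring
      rw [e] at h4
      have : ((r - s) * δ + c / 2 * δ * (d - δ) * d) / d < 1 := by linarith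
      rwa [div_lt_one hd0] at this
    have h6 : r - s ≤ (1 / δ + c / 2 * δ) * d - c / 2 * d ^ 2 := by
      have : (r - s) * δ ≤ ((1 / δ + c / 2 * δ) * d - c / 2 * d ^ 2) * δ := by
        have e : ((1 / δ + c / 2 * δ) * d - c / 2 * d ^ 2) * δ
          = d - c / 2 * δ * (d - δ) * d := by field_simp; ring
        rw [e]; linarith
      exact le_of_mul_le_mul_right this hδ0
    have h7 : (1 / δ + c / 2 * δ) * d - c / 2 * d ^ 2 ≤ (1 / δ + c / 2 * δ) ^ 2 / (2 * c) := by
      rw [le_div_iff₀ (by positivity)]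
      nlinarith [sq_nonneg ((1 / δ + c / 2 * δ) - c * d)]
    linarith

/-- A relatively convex function grows quadratically away from its minimizers. -/
theorem RelConvex.quadratic_growth {c : ℝ} {h : X → EReal} (hb : ∀ x, h x ≠ ⊥)
    (hh : RelConvex c h) {p : X} {m : ℝ} (hm : h p = m) (hmin : ∀ y, (m : EReal) ≤ h y) (y : X) :
    ((m + c / 2 * ‖y - p‖ ^ 2 : ℝ) : EReal) ≤ h y := by
  by_cases hy : h y = ⊤
  · rw [hy]; exact le_top
  obtain ⟨s, hs⟩ := EReal.exists_eq_coe_of_ne (hb y) hy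
  rw [hs]
  norm_cast
  have key : ∀ τ ∈ Ioo (0 : ℝ) 1, m + c / 2 * (1 - τ) * ‖y - p‖ ^ 2 ≤ s := by
    rintro τ ⟨h0, h1⟩
    have h2 := (hmin _).trans (hh p y τ h0 h1 m s hm hs)
    have h2 : m ≤ (1 - τ) * m + τ * s - c / 2 * (τ * (1 - τ)) * ‖p - y‖ ^ 2 := by
      exact_mod_cast h2
    rw [norm_sub_rev] at h2
    have : τ * (m + c / 2 * (1 - τ) * ‖y - p‖ ^ 2) ≤ τ * s := by linarith
    exact le_of_mul_le_mul_left this h0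
  have hlim : Tendsto (fun τ : ℝ => m + c / 2 * (1 - τ) * ‖y - p‖ ^ 2) (𝓝[>] 0)
      (𝓝 (m + c / 2 * (1 - 0) * ‖y - p‖ ^ 2)) :=
    (Continuous.tendsto (by fun_prop) 0).mono_left nhdsWithin_le_nhds
  have := le_of_tendsto hlim
    (mem_of_superset (Ioo_mem_nhdsGT (zero_lt_one' ℝ)) key)
  simpa using this

theorem RelConvex.exists_minimizer [CompleteSpace X] {c : ℝ} (hc : 0 < c) {h : X → EReal}
    (hp : ProperFun h) (hl : LowerSemicontinuous h) (hh : RelConvex c h) :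
    ∃ (p : X) (m : ℝ), h p = m ∧ ∀ y, (m : EReal) ≤ h y := by
  obtain ⟨M, hM⟩ := hh.exists_lower_bound hc hp hl
  obtain ⟨hb, x, hx⟩ := hp
  obtain ⟨r₀, hr₀⟩ := EReal.exists_eq_coe_of_ne (hb x) hx
  set A : Set ℝ := {r | ∃ y, h y = r} with hA
  have hne : A.Nonempty := ⟨r₀, x, hr₀⟩
  have hbdd : BddBelow A := ⟨M, by
    rintro r ⟨y, hy⟩
    have := hM y
    rw [hy] at this
    exact_mod_cast this⟩
  set m := sInf A with hm
  have hmin : ∀ y, (m : EReal) ≤ h y := by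
    intro y
    by_cases hy : h y = ⊤
    · rw [hy]; exact le_top
    obtain ⟨s, hs⟩ := EReal.exists_eq_coe_of_ne (hb y) hy
    rw [hs]
    exact_mod_cast csInf_le hbdd ⟨y, hs⟩
  have hex : ∀ n : ℕ, ∃ y, ∃ r : ℝ, h y = r ∧ r < m + 1 / ((n : ℝ) + 1) := by
    intro n
    obtain ⟨r, ⟨y, hy⟩, hlt⟩ := exists_lt_of_csInf_lt hne
      (show sInf A < m + 1 / ((n : ℝ) + 1) from lt_add_of_pos_right _ (by positivity))
    exact ⟨y, r, hy, hlt⟩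
  choose u r hur hrlt using hex
  have hcauchy : CauchySeq u := by
    -- The midpoint inequality gives `c / 8 * ‖u n - u k‖ ^ 2 ≤ (r n + r k) / 2 - m`, hence the
    -- factor `8 / c`.
    refine cauchySeq_of_le_tendsto_0 (fun N : ℕ => Real.sqrt (8 / c * (1 / ((N : ℝ) + 1)))) ?_ ?_
    · intro n k N hn hk
      rw [dist_eq_norm]
      apply Real.le_sqrt_of_sq_le
      have h1 := (hmin _).trans (hh (u n) (u k) (1 / 2) (by norm_num) (by norm_num) _ _
        (hur n) (hur k))
      have h1 : m ≤ (1 - 1 / 2) * r n + 1 / 2 * r k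
          - c / 2 * (1 / 2 * (1 - 1 / 2)) * ‖u n - u k‖ ^ 2 := by exact_mod_cast h1
      have hn' : 1 / ((n : ℝ) + 1) ≤ 1 / ((N : ℝ) + 1) := Nat.one_div_le_one_div hn
      have hk' : 1 / ((k : ℝ) + 1) ≤ 1 / ((N : ℝ) + 1) := Nat.one_div_le_one_div hk
      have := hrlt n
      have := hrlt k
      rw [div_mul_eq_mul_div, le_div_iff₀ hc]
      linarith
    · have := (tendsto_one_div_add_atTop_nhds_zero_nat (𝕜 := ℝ)).const_mul (8 / c)
      have := this.sqrt
      simpa using this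
  obtain ⟨p, hup⟩ := cauchySeq_tendsto_of_complete hcauchy
  refine ⟨p, m, le_antisymm ?_ (hmin p), hmin⟩
  by_contra hlt
  obtain ⟨t, ht1, ht2⟩ := EReal.lt_iff_exists_real_btwn.1 (not_le.1 hlt)
  have hmt : m < t := by exact_mod_cast ht1
  have hev : ∀ᶠ n in atTop, (t : EReal) < h (u n) := hup.eventually (hl p _ ht2)
  have hev2 : ∀ᶠ n : ℕ in atTop, 1 / ((n : ℝ) + 1) < t - m :=
    (tendsto_one_div_add_atTop_nhds_zero_nat (𝕜 := ℝ)).eventually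
      (gt_mem_nhds (sub_pos.2 hmt))
  obtain ⟨n, hn1, hn2⟩ := (hev.and hev2).exists
  rw [hur n] at hn1
  have hn1 : t < r n := by exact_mod_cast hn1
  have := hrlt n
  linarith

/-! ### Proximal points and subgradients -/

/-- Existence of a proximal point, with its resolvent inclusion. -/
theorem RelConvex.exists_relSubgradient [CompleteSpace X] {a γ : ℝ}
    (ha : 0 < a + 1 / γ) {f : X → EReal} (hf : ProperFun f) (hl : LowerSemicontinuous f)
    (hc : RelConvex a f) (x : X) : ∃ p, RelSubgradient a f p ((1 / γ) • (x - p)) := by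
  have hp' := hf.add_coe fun y => 1 / γ * (‖y - x‖ ^ 2 / 2)
  have hc' := hc.add_quadratic hf.1 (1 / γ) x
  obtain ⟨p, m, hm, hmin⟩ := hc'.exists_minimizer ha hp'
    (hl.add_coe_of_continuous (by fun_prop))
  have hg := hc'.quadratic_growth hp'.1 hm hmin
  have hpt : f p ≠ ⊤ := by
    intro ht
    simp only [ht, EReal.top_add_coe] at hm
    exact EReal.top_ne_coe _ hm
  obtain ⟨r, hr⟩ := EReal.exists_eq_coe_of_ne (hf.1 p) hpt
  refine ⟨p, r, hr, fun y => ?_⟩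
  by_cases hy : f y = ⊤
  · rw [hy]; exact le_top
  obtain ⟨s, hs⟩ := EReal.exists_eq_coe_of_ne (hf.1 y) hy
  have h1 := hg y
  simp only [hr] at hm
  simp only [hs] at h1 ⊢
  norm_cast at h1 hm ⊢
  have e : ‖y - x‖ ^ 2 = ‖y - p‖ ^ 2 - 2 * inner ℝ (x - p) (y - p) + ‖p - x‖ ^ 2 := by
    rw [show y - x = (y - p) - (x - p) by abel, norm_sub_sq_real, norm_sub_rev x p,
      real_inner_comm]
  rw [inner_smul_left]
  simp only [conj_trivial]
  rw [e] at h1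
  linarith

/-- The linear term of the subgradient inequality cancels the cross term of the expanded square, so
the prox objective grows at rate `(a + 1 / γ) / 2` around `p`. -/
theorem RelSubgradient.proxSet_eq {a γ : ℝ} (ha : 0 < a + 1 / γ) {f : X → EReal} {x p : X}
    (h : RelSubgradient a f p ((1 / γ) • (x - p))) : proxSet γ f x = {p} := by
  obtain ⟨r, hr, hs⟩ := h
  have e : ∀ y, 1 / (2 * γ) * ‖x - y‖ ^ 2 = 1 / (2 * γ) * ‖x - p‖ ^ 2
      - inner ℝ ((1 / γ) • (x - p)) (y - p) + 1 / γ / 2 * ‖y - p‖ ^ 2 := by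
    intro y
    rw [show x - y = (x - p) - (y - p) by abel, norm_sub_sq_real, inner_smul_left]
    simp only [conj_trivial]
    rw [one_div_mul_eq_div, ← one_div_mul_one_div]
    ring
  have grow : ∀ y, ((r + 1 / (2 * γ) * ‖x - p‖ ^ 2 + (a + 1 / γ) / 2 * ‖y - p‖ ^ 2 : ℝ) : EReal)
      ≤ f y + ((1 / (2 * γ) * ‖x - y‖ ^ 2 : ℝ) : EReal) := by
    intro y
    refine le_trans (le_of_eq ?_) (add_le_add_left (hs y) _)
    rw [e y]
    norm_cast
    ring
  ext q
  simp only [proxSet, argminSet, mem_ofPred_eq, mem_singleton_iff]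
  constructor
  · intro hq
    have h1 := (grow q).trans (hq p)
    rw [hr] at h1
    norm_cast at h1
    have h2 : (a + 1 / γ) / 2 * ‖q - p‖ ^ 2 ≤ 0 := by linarith
    have h3 : ‖q - p‖ ^ 2 ≤ 0 := by
      by_contra hlt
      push Not at hlt
      have : 0 < (a + 1 / γ) / 2 * ‖q - p‖ ^ 2 := by positivity
      linarith
    have h4 : ‖q - p‖ = 0 := by nlinarith [norm_nonneg (q - p)]
    exact sub_eq_zero.1 (norm_eq_zero.1 h4)
  · rintro rfl y
    refine le_trans ?_ (grow y)
    rw [hr]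
    norm_cast
    have : 0 ≤ (a + 1 / γ) / 2 * ‖y - q‖ ^ 2 := by positivity
    linarith

omit [InnerProductSpace ℝ X] in
theorem prox_eq_of_proxSet_eq {γ : ℝ} {f : X → EReal} {x p : X} (h : proxSet γ f x = {p}) :
    prox γ f x = p := by
  have : prox γ f x ∈ proxSet γ f x :=
    Classical.epsilon_spec (p := fun y => y ∈ proxSet γ f x) ⟨p, by simp [h]⟩
  rwa [h] at this

theorem RelConvex.relSubgradient_prox [CompleteSpace X] {a γ : ℝ}
    (ha : 0 < a + 1 / γ) {f : X → EReal} (hf : ProperFun f) (hl : LowerSemicontinuous f)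
    (hc : RelConvex a f) (x : X) :
    RelSubgradient a f (prox γ f x) ((1 / γ) • (x - prox γ f x)) := by
  obtain ⟨p, hp⟩ := hc.exists_relSubgradient ha hf hl x
  rwa [prox_eq_of_proxSet_eq (hp.proxSet_eq ha)]

theorem RelSubgradient.monotone {a : ℝ} {f : X → EReal} {p q u v : X}
    (hp : RelSubgradient a f p u) (hq : RelSubgradient a f q v) :
    a * ‖p - q‖ ^ 2 ≤ inner ℝ (u - v) (p - q) := by
  obtain ⟨r, hr, h1⟩ := hp
  obtain ⟨s, hs, h2⟩ := hq
  have h1 := h1 q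
  have h2 := h2 p
  rw [hs] at h1
  rw [hr] at h2
  norm_cast at h1 h2
  rw [← neg_sub p q, inner_neg_right, norm_neg] at h1
  rw [inner_sub_left]
  linarith

theorem RelSubgradient.argminSet_add_eq {a b : ℝ} (hab : 0 < a + b) {f g : X → EReal} {p u : X}
    (hf : RelSubgradient a f p u) (hg : RelSubgradient b g p (-u)) :
    argminSet (fun x => f x + g x) = {p} := by
  obtain ⟨r, hr, h1⟩ := hf
  obtain ⟨s, hs, h2⟩ := hg
  have grow : ∀ y, ((r + s + (a + b) / 2 * ‖y - p‖ ^ 2 : ℝ) : EReal) ≤ f y + g y := by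
    intro y
    refine le_trans (le_of_eq ?_) (add_le_add (h1 y) (h2 y))
    rw [inner_neg_left]
    norm_cast
    ring
  ext q
  simp only [argminSet, mem_ofPred_eq, mem_singleton_iff]
  constructor
  · intro hq
    have h1 := (grow q).trans (hq p)
    rw [hr, hs] at h1
    norm_cast at h1
    have h3 : ‖q - p‖ ^ 2 ≤ 0 := by
      by_contra hlt
      push Not at hlt
      have : 0 < (a + b) / 2 * ‖q - p‖ ^ 2 := by positivity
      linarith
    have h4 : ‖q - p‖ = 0 := by nlinarith [norm_nonneg (q - p)]
    exact sub_eq_zero.1 (norm_eq_zero.1 h4)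
  · rintro rfl y
    refine le_trans ?_ (grow y)
    rw [hr, hs]
    norm_cast
    have : 0 ≤ (a + b) / 2 * ‖y - q‖ ^ 2 := by positivity
    linarith

/-- Subtracting `a / 2 * ‖· - z‖ ^ 2` makes `f` convex, where `S` is the convex subdifferential.
Centring the quadratic at `z` makes its gradient there vanish, so the set `S f z` is unchanged. -/
theorem IsAbstractSubdifferential.relSubgradient [CompleteSpace X]
    {S : (X → EReal) → X → Set X} (hS : IsAbstractSubdifferential S) {a : ℝ} {f : X → EReal}
    (hf : ProperFun f) (hl : LowerSemicontinuous f) (hc : RelConvex a f) {z u : X}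
    (hu : u ∈ S f z) : RelSubgradient a f z u := by
  have hp' := hf.add_coe fun y => -a * (‖y - z‖ ^ 2 / 2)
  have hc' := hc.add_quadratic hf.1 (-a) z
  rw [add_neg_cancel] at hc'
  have h1 := hS.add_quadratic f hf hl (-a) z z
  rw [hS.eq_convex _ hp' (hl.add_coe_of_continuous (by fun_prop)) (hc'.eConvex hp'.1)] at h1
  simp only [sub_self, smul_zero, Set.singleton_zero, add_zero] at h1
  rw [← h1] at hu
  simp only [convexSubdifferential, mem_ofPred_eq, sub_self, norm_zero, ne_eq, OfNat.ofNat_ne_zero,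
    not_false_eq_true, zero_pow, zero_div, mul_zero, EReal.coe_zero, add_zero] at hu
  have hzt : f z ≠ ⊤ := by
    intro ht
    obtain ⟨x, hx⟩ := hp'.2
    have := hu x
    rw [ht, EReal.top_add_coe, top_le_iff] at this
    exact hx this
  obtain ⟨r, hr⟩ := EReal.exists_eq_coe_of_ne (hf.1 z) hzt
  refine ⟨r, hr, fun y => ?_⟩
  by_cases hy : f y = ⊤
  · rw [hy]; exact le_top
  obtain ⟨s, hs⟩ := EReal.exists_eq_coe_of_ne (hf.1 y) hy
  have := hu y
  rw [hr, hs] at this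
  rw [hs]
  norm_cast at this ⊢
  linarith

end RelativeConvexity

/-! ### Weak limits, Opial's lemma and demiclosedness -/

section WeakConvergence

variable {X : Type*} [NormedAddCommGroup X] [InnerProductSpace ℝ X] [CompleteSpace X]

theorem tendsto_toWeakSpace_iff_inner {ι : Type*} {l : Filter ι} {u : ι → X} {x : X} :
    Tendsto (fun i => toWeakSpace ℝ X (u i)) l (𝓝 (toWeakSpace ℝ X x)) ↔
      ∀ y, Tendsto (fun i => inner ℝ (u i) y) l (𝓝 (inner ℝ x y)) := by
  have hinj : Function.Injective (topDualPairing ℝ X).flip := by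
    intro v w hvw
    refine ext_inner_left ℝ fun y => ?_
    exact congrArg (fun L => L (InnerProductSpace.toDual ℝ X y)) hvw
  refine (WeakBilin.tendsto_iff_forall_eval_tendsto _ hinj).trans ⟨fun h y => ?_, fun h L => ?_⟩
  · have := h (InnerProductSpace.toDual ℝ X y)
    simp only [real_inner_comm y]
    exact this
  · obtain ⟨y, rfl⟩ := (InnerProductSpace.toDual ℝ X).surjective L
    have := h y
    simp only [real_inner_comm y] at this
    exact this

/-- Weak compactness of balls: a bounded family converges weakly along any ultrafilter. -/
theorem Ultrafilter.exists_tendsto_inner {ι : Type*} (U : Ultrafilter ι) {u : ι → X} {R : ℝ}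
    (hu : ∀ i, ‖u i‖ ≤ R) :
    ∃ x : X, ∀ y, Tendsto (fun i => inner ℝ (u i) y) U (𝓝 (inner ℝ x y)) := by
  let F : ι → WeakDual ℝ X := fun i =>
    StrongDual.toWeakDual (InnerProductSpace.toDual ℝ X (u i))
  have hmem : ∀ i, F i ∈ WeakDual.toStrongDual ⁻¹' Metric.closedBall (0 : StrongDual ℝ X) R := by
    intro i
    change InnerProductSpace.toDual ℝ X (u i) ∈ Metric.closedBall (0 : StrongDual ℝ X) R
    rw [mem_closedBall_zero_iff, LinearIsometryEquiv.norm_map]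
    exact hu i
  obtain ⟨L, -, hL⟩ := (WeakDual.isCompact_closedBall (0 : StrongDual ℝ X) R).ultrafilter_le_nhds
    (U.map F) (by
      rw [Ultrafilter.coe_map, le_principal_iff]
      exact Filter.mem_map.2 (Filter.univ_mem' hmem))
  refine ⟨(InnerProductSpace.toDual ℝ X).symm (WeakDual.toStrongDual L), fun y => ?_⟩
  have := tendsto_iff_forall_eval_tendsto_topDualPairing.1
    (show Tendsto F U (𝓝 L) from hL) y
  rw [InnerProductSpace.toDual_symm_apply]
  exact this

/-- Opial's lemma: a sequence whose distances to the points of `C` converge, and whose weak cluster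
points lie in `C`, converges weakly to a point of `C`. -/
theorem exists_tendsto_inner_of_opial {u : ℕ → X} {C : Set X}
    (hdist : ∀ z ∈ C, ∃ d, Tendsto (fun n => ‖u n - z‖ ^ 2) atTop (𝓝 d)) {R : ℝ}
    (hR : ∀ n, ‖u n‖ ≤ R)
    (hcluster : ∀ U : Ultrafilter ℕ, ↑U ≤ (atTop : Filter ℕ) → ∀ x,
      (∀ y, Tendsto (fun n => inner ℝ (u n) y) U (𝓝 (inner ℝ x y))) → x ∈ C) :
    ∃ x ∈ C, ∀ y, Tendsto (fun n => inner ℝ (u n) y) atTop (𝓝 (inner ℝ x y)) := by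
  have hlim : ∀ y ∈ C, ∀ z ∈ C, ∃ L, Tendsto (fun n => inner ℝ (u n) (y - z)) atTop (𝓝 L) := by
    intro y hy z hz
    obtain ⟨d, hd⟩ := hdist y hy
    obtain ⟨e, he⟩ := hdist z hz
    refine ⟨_, (((he.sub hd).add_const (‖y‖ ^ 2 - ‖z‖ ^ 2)).div_const 2).congr fun n => ?_⟩
    rw [norm_sub_sq_real, norm_sub_sq_real, inner_sub_right]
    ring
  obtain ⟨x, hx⟩ := (Ultrafilter.of (atTop : Filter ℕ)).exists_tendsto_inner hR
  have hxC := hcluster _ (Ultrafilter.of_le _) x hx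
  refine ⟨x, hxC, fun y => (tendsto_iff_ultrafilter _ _ _).2 fun V hV => ?_⟩
  obtain ⟨x', hx'⟩ := V.exists_tendsto_inner hR
  have hxC' := hcluster V hV x' hx'
  obtain ⟨L, hL⟩ := hlim x hxC x' hxC'
  -- Both cluster points pair with `x - x'` to the same limit `L`, so `x - x'` is orthogonal to
  -- itself.
  have h1 := tendsto_nhds_unique (hx (x - x')) (hL.mono_left (Ultrafilter.of_le _))
  have h2 := tendsto_nhds_unique (hx' (x - x')) (hL.mono_left hV)
  have h3 : x = x' := by
    rw [← sub_eq_zero, ← inner_self_eq_zero (𝕜 := ℝ), inner_sub_left, h1, h2, sub_self]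
  rw [h3]
  exact hx' y

omit [CompleteSpace X] in
/-- Demiclosedness principle for nonexpansive maps. -/
theorem LipschitzWith.isFixedPt_of_tendsto_inner {ι : Type*} {l : Filter ι} [l.NeBot] {T : X → X}
    (hT : LipschitzWith 1 T) {u : ι → X} {x : X} {R : ℝ} (hR : ∀ i, ‖u i‖ ≤ R)
    (hu : Tendsto (fun i => ‖u i - T (u i)‖) l (𝓝 0))
    (hx : ∀ y, Tendsto (fun i => inner ℝ (u i) y) l (𝓝 (inner ℝ x y))) :
    Function.IsFixedPt T x := by
  -- Expand `‖u i - T x‖ ^ 2` around `x` and compare with nonexpansiveness; the right-hand side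
  -- tends to `0`.
  have hbound : ∀ i, ‖x - T x‖ ^ 2 ≤ -2 * (inner ℝ (u i) (x - T x) - inner ℝ x (x - T x))
      + (‖u i - T (u i)‖ ^ 2 + 2 * ‖u i - T (u i)‖ * (R + ‖x‖)) := by
    intro i
    have h1 : ‖u i - T x‖ ≤ ‖u i - T (u i)‖ + ‖u i - x‖ := by
      have := hT.norm_sub_le (u i) x
      rw [NNReal.coe_one, one_mul] at this
      have := norm_sub_le_norm_sub_add_norm_sub (u i) (T (u i)) (T x)
      linarith
    have h2 : ‖u i - x‖ ≤ R + ‖x‖ := (_root_.norm_sub_le _ _).trans (by linarith [hR i])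
    have h3 : ‖u i - T x‖ ^ 2 = ‖u i - x‖ ^ 2
        + 2 * (inner ℝ (u i) (x - T x) - inner ℝ x (x - T x)) + ‖x - T x‖ ^ 2 := by
      rw [← inner_sub_left, ← norm_add_sq_real, sub_add_sub_cancel]
    have h4 := pow_le_pow_left₀ (norm_nonneg _) h1 2
    have h5 := mul_le_mul_of_nonneg_left h2 (norm_nonneg (u i - T (u i)))
    nlinarith
  have hlim := (((hx (x - T x)).sub_const (inner ℝ x (x - T x))).const_mul (-2)).add
    ((hu.pow 2).add ((hu.const_mul 2).mul_const (R + ‖x‖)))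
  have := ge_of_tendsto' hlim hbound
  simp only [sub_self, mul_zero, zero_mul, add_zero, ne_eq, OfNat.ofNat_ne_zero,
    not_false_eq_true, zero_pow] at this
  have h0 : ‖x - T x‖ = 0 := by nlinarith [norm_nonneg (x - T x)]
  exact (sub_eq_zero.1 (norm_eq_zero.1 h0)).symm

end WeakConvergence

/-! ### The Douglas-Rachford estimate and convergence -/

section DouglasRachfordConvergence

variable {X : Type*} [NormedAddCommGroup X] [InnerProductSpace ℝ X]

theorem isAveraged_of_norm_sq_le {α : ℝ} (hα : α ∈ Ioo (0 : ℝ) 1) {T : X → X}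
    (hT : ∀ x y, ‖T x - T y‖ ^ 2 + (1 - α) / α * ‖(x - T x) - (y - T y)‖ ^ 2 ≤ ‖x - y‖ ^ 2) :
    IsAveraged α T := by
  have h0 := hα.1
  refine ⟨hα, fun x => (1 / α) • (T x - (1 - α) • x), ?_, fun x => ?_⟩
  · refine LipschitzWith.of_dist_le_mul fun x y => ?_
    rw [NNReal.coe_one, one_mul, dist_eq_norm, dist_eq_norm]
    refine (sq_le_sq₀ (norm_nonneg _) (norm_nonneg _)).1 ?_
    have h := hT x y
    have e1 : (1 / α) • (T x - (1 - α) • x) - (1 / α) • (T y - (1 - α) • y)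
        = (1 / α) • ((T x - T y) - (1 - α) • (x - y)) := by module
    have e2 : (x - T x) - (y - T y) = (x - y) - (T x - T y) := by abel
    rw [e2] at h
    rw [e1]
    clear e1 e2
    generalize T x - T y = A at *
    generalize x - y = B at *
    rw [norm_sub_sq_real, real_inner_comm] at h
    rw [ norm_smul, mul_pow, norm_sub_sq_real, inner_smul_right, norm_smul, mul_pow]
    simp only [Real.norm_eq_abs, sq_abs]
    rw [one_div, inv_pow, inv_mul_le_iff₀ (by positivity)]
    have h' := mul_le_mul_of_nonneg_left h h0.le
    have e3 : ∀ t : ℝ, α * ((1 - α) / α * t) = (1 - α) * t := fun t => by field_simp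
    rw [mul_add, e3] at h'
    linarith
  · rw [smul_smul, mul_one_div_cancel h0.ne']
    module

/-- The identity and monotonicity estimate behind the Douglas-Rachford operator, for increments
`x`, `p`, `q` of the argument and of the two resolvents. -/
theorem norm_sq_douglasRachford_le {a b γ : ℝ} (hγ : 0 < γ) (hab : 0 < a + b) {x p q : X}
    (hp : γ * a * ‖p‖ ^ 2 ≤ inner ℝ (x - p) p)
    (hq : γ * b * ‖q‖ ^ 2 ≤ inner ℝ ((2 : ℝ) • p - x - q) q) :
    ‖x + q - p‖ ^ 2 + (1 + 2 * γ * (a * b) / (a + b)) * ‖p - q‖ ^ 2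
      + 2 * γ / (a + b) * ‖a • p + b • q‖ ^ 2 ≤ ‖x‖ ^ 2 := by
  have e1 : ‖x + q - p‖ ^ 2 = ‖x‖ ^ 2 - 2 * inner ℝ x p + 2 * inner ℝ x q + ‖p - q‖ ^ 2 := by
    rw [show x + q - p = x - (p - q) by abel, norm_sub_sq_real, inner_sub_right]
    ring
  have e2 : ‖a • p + b • q‖ ^ 2 =
      (a + b) * (a * ‖p‖ ^ 2 + b * ‖q‖ ^ 2) - a * b * ‖p - q‖ ^ 2 := by
    rw [norm_add_sq_real, norm_sub_sq_real, norm_smul, norm_smul, inner_smul_left,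
      inner_smul_right, mul_pow, mul_pow]
    simp only [Real.norm_eq_abs, sq_abs, conj_trivial]
    ring
  have e3 : 2 * γ / (a + b) * ‖a • p + b • q‖ ^ 2 =
      2 * γ * (a * ‖p‖ ^ 2 + b * ‖q‖ ^ 2) - 2 * γ * (a * b) / (a + b) * ‖p - q‖ ^ 2 := by
    rw [e2]
    field_simp
  rw [inner_sub_left, real_inner_self_eq_norm_sq] at hp
  rw [inner_sub_left, inner_sub_left, inner_smul_left, real_inner_self_eq_norm_sq] at hq
  simp only [conj_trivial] at hq
  rw [e3, e1]
  have e4 := norm_sub_sq_real p q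
  linarith

theorem drMap_eq (γ : ℝ) (f g : X → EReal) (x : X) :
    drMap γ f g x = x + prox γ g ((2 : ℝ) • prox γ f x - x) - prox γ f x := by
  unfold drMap
  module

theorem isFixedPt_drMap_iff {γ : ℝ} {f g : X → EReal} {x : X} :
    Function.IsFixedPt (drMap γ f g) x ↔
      prox γ g ((2 : ℝ) • prox γ f x - x) = prox γ f x := by
  rw [Function.IsFixedPt, drMap_eq, add_sub_assoc, add_eq_left, sub_eq_zero]

/-- Two functions with the resolvents of `γ f` and `γ g` well-behaved, `f` being `a`-convex and `g`
being `b`-convex with `a + b` positive. -/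
structure ProxPair (a b γ : ℝ) (f g : X → EReal) : Prop where
  pos : 0 < γ
  left : 0 < a + 1 / γ
  right : 0 < b + 1 / γ
  add_pos : 0 < a + b
  prox_left : ∀ x, RelSubgradient a f (prox γ f x) ((1 / γ) • (x - prox γ f x))
  prox_right : ∀ x, RelSubgradient b g (prox γ g x) ((1 / γ) • (x - prox γ g x))

namespace ProxPair

variable {a b γ : ℝ} {f g : X → EReal}

theorem norm_sq_le (h : ProxPair a b γ f g) (x y : X) :
    ‖drMap γ f g x - drMap γ f g y‖ ^ 2
      + (1 + 2 * γ * (a * b) / (a + b)) *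
        ‖(x - drMap γ f g x) - (y - drMap γ f g y)‖ ^ 2
      + 2 * γ / (a + b) * ‖a • (prox γ f x - prox γ f y) + b •
        (prox γ g ((2 : ℝ) • prox γ f x - x) - prox γ g ((2 : ℝ) • prox γ f y - y))‖ ^ 2
      ≤ ‖x - y‖ ^ 2 := by
  have hγ := h.pos
  have scale : ∀ {c t : ℝ} {v w : X}, c * t ≤ inner ℝ ((1 / γ) • v) w →
      γ * c * t ≤ inner ℝ v w := by
    intro c t v w hvw
    rw [inner_smul_left] at hvw
    simp only [conj_trivial] at hvw
    have := mul_le_mul_of_nonneg_left hvw hγ.le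
    rwa [← mul_assoc, ← mul_assoc, mul_one_div_cancel hγ.ne', one_mul] at this
  have hp := (h.prox_left x).monotone (h.prox_left y)
  have hq := (h.prox_right ((2 : ℝ) • prox γ f x - x)).monotone
    (h.prox_right ((2 : ℝ) • prox γ f y - y))
  rw [drMap_eq, drMap_eq]
  set p := prox γ f x
  set p' := prox γ f y
  set q := prox γ g ((2 : ℝ) • p - x)
  set q' := prox γ g ((2 : ℝ) • p' - y)
  rw [← smul_sub] at hp hq
  have hp := scale hp
  have hq := scale hq
  rw [show x - p - (y - p') = (x - y) - (p - p') by abel] at hp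
  rw [show (2 : ℝ) • p - x - q - ((2 : ℝ) • p' - y - q')
    = (2 : ℝ) • (p - p') - (x - y) - (q - q') by module] at hq
  have := norm_sq_douglasRachford_le hγ h.add_pos hp hq
  rwa [show x - y + (q - q') - (p - p') = (x + q - p) - (y + q' - p') by abel,
    show (p - p') - (q - q') = (x - (x + q - p)) - (y - (y + q' - p')) by abel] at this

theorem argminSet_eq (h : ProxPair a b γ f g) {x : X}
    (hx : Function.IsFixedPt (drMap γ f g) x) :
    argminSet (fun y => f y + g y) = {prox γ f x} := by
  have hq := h.prox_right ((2 : ℝ) • prox γ f x - x)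
  rw [isFixedPt_drMap_iff.1 hx] at hq
  refine (h.prox_left x).argminSet_add_eq h.add_pos ?_
  convert hq using 1
  module

theorem exists_isFixedPt (h : ProxPair a b γ f g) {z u : X} (hf : RelSubgradient a f z u)
    (hg : RelSubgradient b g z (-u)) : ∃ x, Function.IsFixedPt (drMap γ f g) x := by
  have hγ := h.pos.ne'
  have h1 : prox γ f (z + γ • u) = z := by
    refine prox_eq_of_proxSet_eq (RelSubgradient.proxSet_eq h.left ?_)
    rwa [add_sub_cancel_left, smul_smul, one_div_mul_cancel hγ, one_smul]
  have h2 : prox γ g (z - γ • u) = z := by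
    refine prox_eq_of_proxSet_eq (RelSubgradient.proxSet_eq h.right ?_)
    rwa [sub_sub_cancel_left, ← smul_neg, smul_smul, one_div_mul_cancel hγ, one_smul]
  refine ⟨z + γ • u, isFixedPt_drMap_iff.2 ?_⟩
  rw [h1, show (2 : ℝ) • z - (z + γ • u) = z - γ • u by module, h2]

theorem lipschitzWith_one (h : ProxPair a b γ f g) (hκ : 0 < 1 + 2 * γ * (a * b) / (a + b)) :
    LipschitzWith 1 (drMap γ f g) := by
  refine LipschitzWith.of_dist_le_mul fun x y => ?_
  rw [NNReal.coe_one, one_mul, dist_eq_norm, dist_eq_norm]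
  refine (sq_le_sq₀ (norm_nonneg _) (norm_nonneg _)).1 (le_trans ?_ (h.norm_sq_le x y))
  have := h.pos
  have := h.add_pos
  rw [add_assoc]
  exact le_add_of_nonneg_right (by positivity)

theorem exists_tendsto [CompleteSpace X] (h : ProxPair a b γ f g)
    (hκ : 0 < 1 + 2 * γ * (a * b) / (a + b)) (hfix : ∃ x, Function.IsFixedPt (drMap γ f g) x)
    (x₀ : X) : ∃ x ∈ Function.fixedPoints (drMap γ f g),
      (∀ y, Tendsto (fun n => inner ℝ ((drMap γ f g)^[n] x₀) y) atTop (𝓝 (inner ℝ x y))) ∧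
      Tendsto (fun n : ℕ => prox γ f ((drMap γ f g)^[n] x₀)) atTop (𝓝 (prox γ f x)) := by
  have hγ := h.pos
  have hab := h.add_pos
  set T := drMap γ f g with hT
  set u : ℕ → X := fun n => T^[n] x₀ with hu
  have hsucc : ∀ n, u (n + 1) = T (u n) := fun n => Function.iterate_succ_apply' T n x₀
  set κ := 1 + 2 * γ * (a * b) / (a + b) with hκdef
  have step : ∀ z, Function.IsFixedPt T z → ∀ n, ‖u (n + 1) - z‖ ^ 2
      + κ * ‖u n - T (u n)‖ ^ 2 + 2 * γ / (a + b) * ‖a • (prox γ f (u n) - prox γ f z)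
        + b • (prox γ g ((2 : ℝ) • prox γ f (u n) - u n) - prox γ f z)‖ ^ 2
      ≤ ‖u n - z‖ ^ 2 := by
    intro z hz n
    rw [hsucc]
    have := h.norm_sq_le (u n) z
    rwa [← hT, hz.eq, sub_self, sub_zero, isFixedPt_drMap_iff.1 hz, ← hκdef] at this
  have hanti : ∀ z, Function.IsFixedPt T z → Antitone fun n => ‖u n - z‖ ^ 2 := by
    intro z hz
    refine antitone_nat_of_succ_le fun n => le_trans ?_ (step z hz n)
    rw [add_assoc]
    exact le_add_of_nonneg_right (by positivity)
  have hlim : ∀ z, Function.IsFixedPt T z → ∃ d, Tendsto (fun n => ‖u n - z‖ ^ 2) atTop (𝓝 d) :=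
    fun z hz => ⟨_, tendsto_atTop_ciInf (hanti z hz) ⟨0, by rintro _ ⟨n, rfl⟩; positivity⟩⟩
  have hdiff : ∀ z, Function.IsFixedPt T z →
      Tendsto (fun n => ‖u n - z‖ ^ 2 - ‖u (n + 1) - z‖ ^ 2) atTop (𝓝 0) := by
    intro z hz
    obtain ⟨d, hd⟩ := hlim z hz
    simpa using hd.sub ((tendsto_add_atTop_iff_nat 1).2 hd)
  -- Each nonnegative term dropped from `step` is bounded by the decrements of the convergent
  -- sequence `‖u n - z‖ ^ 2`.
  have norm_tendsto : ∀ {c : ℝ}, 0 < c → ∀ {z}, Function.IsFixedPt T z → ∀ v : ℕ → X,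
      (∀ n, c * ‖v n‖ ^ 2 ≤ ‖u n - z‖ ^ 2 - ‖u (n + 1) - z‖ ^ 2) → Tendsto v atTop (𝓝 0) := by
    intro c hc z hz v hv
    rw [tendsto_zero_iff_norm_tendsto_zero]
    have h1 : Tendsto (fun n => ‖v n‖ ^ 2) atTop (𝓝 0) := by
      refine squeeze_zero (fun n => by positivity) (fun n => ?_)
        (by simpa using (hdiff z hz).div_const c)
      rw [le_div_iff₀ hc, mul_comm]
      exact hv n
    simpa [Real.sqrt_sq] using h1.sqrt
  have hres : ∀ {z}, Function.IsFixedPt T z → Tendsto (fun n => u n - T (u n)) atTop (𝓝 0) := by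
    intro z hz
    refine norm_tendsto hκ hz _ fun n => ?_
    have := step z hz n
    have : 0 ≤ 2 * γ / (a + b) * ‖a • (prox γ f (u n) - prox γ f z)
        + b • (prox γ g ((2 : ℝ) • prox γ f (u n) - u n) - prox γ f z)‖ ^ 2 := by positivity
    linarith
  obtain ⟨z, hz⟩ := hfix
  have hR : ∀ n, ‖u n‖ ≤ ‖u 0 - z‖ + ‖z‖ := by
    intro n
    have h1 : ‖u n - z‖ ≤ ‖u 0 - z‖ :=
      (sq_le_sq₀ (norm_nonneg _) (norm_nonneg _)).1 (hanti z hz (Nat.zero_le n))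
    have := norm_le_norm_sub_add (u n) z
    linarith
  obtain ⟨x, hx, hweak⟩ := exists_tendsto_inner_of_opial (C := Function.fixedPoints T)
    hlim hR fun U hU x hx => (h.lipschitzWith_one hκ).isFixedPt_of_tendsto_inner hR
      ((tendsto_zero_iff_norm_tendsto_zero.1 (hres hz)).mono_left hU) hx
  refine ⟨x, hx, hweak, ?_⟩
  have hcomb := norm_tendsto (c := 2 * γ / (a + b)) (by positivity) hx
    (fun n => a • (prox γ f (u n) - prox γ f x)
      + b • (prox γ g ((2 : ℝ) • prox γ f (u n) - u n) - prox γ f x)) fun n => by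
      have := step x hx n
      have : 0 ≤ κ * ‖u n - T (u n)‖ ^ 2 := by positivity
      linarith
  have hsum := (hcomb.add ((hres hx).const_smul b)).const_smul (1 / (a + b))
  rw [smul_zero, add_zero, smul_zero] at hsum
  rw [← tendsto_sub_nhds_zero_iff]
  refine hsum.congr fun n => ?_
  rw [hT, drMap_eq]
  -- Adding `b` times the residual `p - q` eliminates `q` and isolates the error of the first
  -- resolvent.
  have e : ∀ p q v : X, a • (p - v) + b • (q - v) + b • (u n - (u n + q - p))
      = (a + b) • (p - v) := fun p q v => by module
  rw [e, smul_smul, one_div_mul_cancel hab.ne', one_smul]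

end ProxPair

end DouglasRachfordConvergence

/-! ### Assembly of the theorem -/

theorem mainTheorem11 {X : Type*} [NormedAddCommGroup X] [InnerProductSpace ℝ X] [CompleteSpace X]
    (S : (X → EReal) → X → Set X) (hS : IsAbstractSubdifferential S)
    (f g : X → EReal)
    (hf : ProperFun f) (hf_lsc : LowerSemicontinuous f)
    (hg : ProperFun g) (hg_lsc : LowerSemicontinuous g)
    (μ ω γ : ℝ) (hω : 0 ≤ ω) (hμω : ω < μ)
    (hγ : 0 < γ) (hγ_lt : 0 < ω → γ < (μ - ω) / (2 * μ * ω))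
    (hfg : (EStronglyConvex μ f ∧ EHypoconvex ω g) ∨ (EHypoconvex ω f ∧ EStronglyConvex μ g))
    (hzero : ∃ z, (0 : X) ∈ S f z + S g z) :
    -- the proximal mappings are single-valued with full domain
    (∀ x, proxSet γ f x = {prox γ f x}) ∧ (∀ x, proxSet γ g x = {prox γ g x}) ∧
    (μ - ω) / (2 * (μ - ω - γ * μ * ω)) ∈ Ioo (0 : ℝ) 1 ∧
    IsAveraged ((μ - ω) / (2 * (μ - ω - γ * μ * ω))) (drMap γ f g) ∧
    ∀ x₀ : X, ∃ xbar ∈ Function.fixedPoints (drMap γ f g),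
      Tendsto (fun n : ℕ => toWeakSpace ℝ X ((drMap γ f g)^[n] x₀)) atTop
        (𝓝 (toWeakSpace ℝ X xbar)) ∧
      argminSet (fun x => f x + g x) = {prox γ f xbar} ∧
      Tendsto (fun n : ℕ => prox γ f ((drMap γ f g)^[n] x₀)) atTop (𝓝 (prox γ f xbar)) := by
  have hμ : 0 < μ := hω.trans_lt hμω
  have hd : 0 < μ - ω := sub_pos.2 hμω
  have hprod : 2 * (γ * μ * ω) < μ - ω := by
    rcases hω.eq_or_lt with rfl | hω'
    · simpa using hd
    · have := (lt_div_iff₀ (by positivity)).1 (hγ_lt hω')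
      linarith
  -- Otherwise `μ ≤ γ * μ * ω`, whence `2 * μ < μ - ω`, which is absurd.
  have hωγ : ω < 1 / γ := by
    rw [lt_div_iff₀ hγ]
    by_contra! hle
    have := mul_le_mul_of_nonneg_left hle hμ.le
    linarith
  obtain ⟨a, b, hfa, hgb, ha, hb, hab, hmul⟩ : ∃ a b : ℝ, RelConvex a f ∧ RelConvex b g ∧
      0 < a + 1 / γ ∧ 0 < b + 1 / γ ∧ a + b = μ - ω ∧ a * b = -(μ * ω) := by
    have hμγ : 0 < μ + 1 / γ := by positivity
    rcases hfg with ⟨hf', hg'⟩ | ⟨hf', hg'⟩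
    · exact ⟨μ, -ω, hf'.relConvex, hg'.relConvex, hμγ, by linarith, by ring, by ring⟩
    · exact ⟨-ω, μ, hf'.relConvex, hg'.relConvex, by linarith, hμγ, by ring, by ring⟩
  have h : ProxPair a b γ f g :=
    ⟨hγ, ha, hb, hab ▸ hd, hfa.relSubgradient_prox ha hf hf_lsc,
      hgb.relSubgradient_prox hb hg hg_lsc⟩
  have hden : 0 < μ - ω - γ * μ * ω := by linarith
  have hκ : 1 + 2 * γ * (a * b) / (a + b) = (μ - ω - 2 * (γ * μ * ω)) / (μ - ω) := by
    rw [hab, hmul]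
    field_simp
    ring
  have hκ0 : 0 < 1 + 2 * γ * (a * b) / (a + b) := by
    rw [hκ]
    exact div_pos (by linarith) hd
  have hα : (μ - ω) / (2 * (μ - ω - γ * μ * ω)) ∈ Ioo (0 : ℝ) 1 :=
    ⟨by positivity, (div_lt_one (by positivity)).2 (by linarith)⟩
  refine ⟨fun x => (h.prox_left x).proxSet_eq ha, fun x => (h.prox_right x).proxSet_eq hb, hα,
    isAveraged_of_norm_sq_le hα fun x y => ?_, fun x₀ => ?_⟩
  · have hα' : (1 - (μ - ω) / (2 * (μ - ω - γ * μ * ω))) / ((μ - ω) / (2 * (μ - ω - γ * μ * ω)))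
        = 1 + 2 * γ * (a * b) / (a + b) := by
      rw [hκ, show μ - ω - 2 * (γ * μ * ω) = 2 * (μ - ω - γ * μ * ω) - (μ - ω) by ring]
      generalize μ - ω - γ * μ * ω = D at hden
      generalize μ - ω = d at hd
      field_simp
    rw [hα']
    refine le_trans (le_add_of_nonneg_right ?_) (h.norm_sq_le x y)
    have := h.add_pos
    positivity
  · obtain ⟨z, u, hu, v, hv, huv⟩ := hzero
    obtain rfl : v = -u := (neg_eq_of_add_eq_zero_right huv).symm
    obtain ⟨x, hx, hweak, hstrong⟩ := h.exists_tendsto hκ0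
      (h.exists_isFixedPt (hS.relSubgradient hf hf_lsc hfa hu)
        (hS.relSubgradient hg hg_lsc hgb hv)) x₀
    exact ⟨x, hx, tendsto_toWeakSpace_iff_inner.2 hweak, h.argminSet_eq hx, hstrong⟩
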